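/- Let $H$ be a complex Hilbert space, let $B(H)$ be the algebra of bounded linear operators on $H$ with identity $I$, and let $N\in B(H)$ be normal. For $T\in B(H)$ write $|T|=(T^*T)^{1/2}$ and, for an integer $n\ge 1$, let $|T|^{1/n}$ denote the unique positive $n$th root of the positive operator $|T|$. Then there is a self-adjoint operator $A\in B(H)$ such that \[N=e^{iA}|N|=|N|e^{iA}\] and such that, for every integer $n\ge 1$ and every $k\in\mathbb Z$, the operator \[M=|N|^{1/n}\,e^{\,i\,(A+2k\pi I)/n}\] is normal and satisfies $M^n=N$. In particular, $N$ has a normal $n$th root for every integer $n\ge 1$. -/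

import Mathlib

/-!
Write `N = X + iY` with `X`, `Y` the real and imaginary parts, which are commuting self-adjoint
operators satisfying `|N|² = X² + Y²`. The argument of a complex number `z = x + iy` is
`± arccos (x / |z|)`, with the sign of `y`; although this is not a continuous function of `z`, each
of the two discontinuous ingredients can be built by hand, without a Borel functional calculus.

* The quotient `x / |z|`: as `‖X v‖ ≤ ‖|N| v‖`, the map `|N| v ↦ X v` extends to a contraction,
  whose self-adjoint part `C` satisfies `C |N| = X`
  (`ContinuousLinearMap.exists_isSelfAdjoint_mul_eq`).
* The sign of `y`: if `E` is the orthogonal projection onto the kernel of the negative part of `Y`,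
  then `(2E - 1) |Y| = Y` (`ContinuousLinearMap.exists_isStarProjection_sign`).

The continuous functional calculus gives `B = arccos C`, and `A = (2E - 1) B` is the required
operator: `exp (iB) = C + i √(1 - C²)` implies `exp (iA) = C + i (2E - 1) √(1 - C²)`, while
`|N| √(1 - C²)` is the positive square root of `|N|² - X² = Y²`, hence equals `|Y|`. So
`|N| exp (iA) = X + i (2E - 1) |Y| = N`. Both `C` and `E` commute with every self-adjoint operator
that commutes with the data they were built from, so `A` commutes with `|N|` and therefore
with `|N|^(1/n)`, from which the statements on the roots follow.
-/

open Complex ContinuousLinearMap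
open scoped ComplexStarModule

/-! ### Division and sign for operators on a Hilbert space -/

section Operators

variable {H : Type*} [NormedAddCommGroup H] [InnerProductSpace ℂ H] [CompleteSpace H]

/-- A self-adjoint `T` commuting with `p` leaves the kernel of `p` and its orthogonal complement
invariant. -/
lemma ContinuousLinearMap.commute_starProjection_ker {p T : H →L[ℂ] H}
    (hT : IsSelfAdjoint T) (h : Commute T p) : Commute T p.ker.starProjection := by
  have hmap : ∀ v ∈ p.ker, T v ∈ p.ker := fun v hv ↦ by
    have h1 : p (T v) = T (p v) := (DFunLike.congr_fun h.eq v).symm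
    have h2 : p v = 0 := hv
    show p (T v) = 0
    rw [h1, h2, map_zero]
  refine ContinuousLinearMap.ext fun v ↦ ?_
  show T (p.ker.starProjection v) = p.ker.starProjection (T v)
  refine (Submodule.eq_starProjection_of_mem_orthogonal
    (hmap _ (Submodule.starProjection_apply_mem _ v)) ?_).symm
  rw [← map_sub]
  intro u hu
  rw [← hT.isSymmetric.apply_clm u]
  exact Submodule.sub_starProjection_mem_orthogonal v _ (hmap u hu)

/-- A contractive quotient `C` of `X` by `p`, commuting with every self-adjoint operator that
commutes with `p` and `X`. -/
lemma ContinuousLinearMap.exists_isSelfAdjoint_mul_eq {p X : H →L[ℂ] H} (hp : IsSelfAdjoint p)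
    (hX : IsSelfAdjoint X) (hpX : Commute p X) (hle : ∀ v, ‖X v‖ ≤ ‖p v‖) :
    ∃ C : H →L[ℂ] H, IsSelfAdjoint C ∧ ‖C‖ ≤ 1 ∧ C * p = X ∧
      ∀ T : H →L[ℂ] H, IsSelfAdjoint T → Commute T p → Commute T X → Commute T C := by
  -- The quotient `D` is the continuous extension of `p v ↦ X v` to the closure of the range of `p`,
  -- composed with the orthogonal projection onto that subspace.
  set K := p.range.topologicalClosure with hK
  have hKmem : ∀ v, p v ∈ K := fun v ↦ p.range.le_topologicalClosure ⟨v, rfl⟩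
  let e : H →ₗ[ℂ] K := p.toLinearMap.codRestrict K hKmem
  have hdense : DenseRange e := by
    rw [DenseRange, Subtype.dense_iff]
    intro v hv
    refine closure_mono (s := (p.range : Set H)) ?_ hv
    rintro _ ⟨w, rfl⟩
    exact ⟨e w, ⟨w, rfl⟩, rfl⟩
  have hnorm : ∀ v, ‖X.toLinearMap v‖ ≤ 1 * ‖e v‖ := fun v ↦ by
    rw [one_mul]; exact hle v
  let D₀ : K →L[ℂ] H := X.toLinearMap.extendOfNorm e
  have hD₀ : ∀ v, D₀ (e v) = X v := fun v ↦ LinearMap.extendOfNorm_eq hdense ⟨1, hnorm⟩ v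
  let D : H →L[ℂ] H := D₀ ∘L K.orthogonalProjectionOnto
  have hDnorm : ‖D‖ ≤ 1 := by
    refine ContinuousLinearMap.opNorm_le_bound _ zero_le_one fun v ↦ ?_
    refine (LinearMap.norm_extendOfNorm_apply_le hdense 1 hnorm _).trans ?_
    gcongr
    exact K.norm_orthogonalProjectionOnto_apply_le v
  have hDp : ∀ v, D (p v) = X v := fun v ↦ by
    have : K.orthogonalProjectionOnto (p v) = e v :=
      K.orthogonalProjectionOnto_mem_subspace_eq_self (e v)
    show D₀ (K.orthogonalProjectionOnto (p v)) = X v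
    rw [this, hD₀]
  have hKorth : Kᗮ = p.ker := by
    rw [hK, Submodule.orthogonal_closure, ContinuousLinearMap.orthogonal_range, hp.adjoint_eq]
  have hDker : ∀ v, p v = 0 → D v = 0 := fun v hv ↦ by
    have hv' : v ∈ Kᗮ := by rw [hKorth]; exact hv
    show D₀ (K.orthogonalProjectionOnto v) = 0
    rw [Submodule.orthogonalProjectionOnto_apply_of_mem_orthogonal hv', map_zero]
  -- `D` inherits commutation relations separately on the closure of the range of `p` and on the
  -- orthogonal complement of that subspace, which is the kernel of `p`.
  have hDT : ∀ T : H →L[ℂ] H, Commute T p → Commute T X → Commute T D := by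
    intro T hTp hTX
    have hTp' : ∀ v, T (p v) = p (T v) := fun v ↦ DFunLike.congr_fun hTp.eq v
    have hTX' : ∀ v, T (X v) = X (T v) := fun v ↦ DFunLike.congr_fun hTX.eq v
    have hcl : ∀ w ∈ K, T (D w) = D (T w) := by
      intro w hw
      have hclosed : IsClosed {w : H | T (D w) = D (T w)} :=
        isClosed_eq (by fun_prop) (by fun_prop)
      refine closure_minimal (s := (p.range : Set H)) ?_ hclosed hw
      rintro _ ⟨v, rfl⟩
      show T (D (p v)) = D (T (p v))
      rw [hDp, hTp', hDp, hTX']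
    refine ContinuousLinearMap.ext fun v ↦ ?_
    show T (D v) = D (T v)
    obtain ⟨y, hy, z, hz, rfl⟩ := K.exists_add_mem_mem_orthogonal v
    have hz0 : p z = 0 := by rw [hKorth] at hz; exact hz
    rw [map_add, map_add, map_add, map_add, hcl y hy, hDker z hz0, map_zero,
      hDker (T z) (by rw [← hTp', hz0, map_zero])]
  have hDp' : D * p = X := ContinuousLinearMap.ext hDp
  have hDsp : star D * p = X := by
    have h1 : p * D = X := by rw [(hDT p (.refl p) hpX).eq, hDp']
    rw [← hX.star_eq, ← h1, star_mul, hp.star_eq]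
  clear_value D
  -- Passing to the self-adjoint part of `D` keeps all its properties, as `p` and `X` are self-adjoint.
  refine ⟨(2⁻¹ : ℝ) • (D + star D), ?_, ?_, ?_, fun T hT hTp hTX ↦ ?_⟩
  · rw [isSelfAdjoint_iff, star_smul, star_add, star_star, star_trivial, add_comm]
  · rw [norm_smul]
    have := norm_add_le D (star D)
    rw [norm_star] at this
    norm_num
    linarith
  · rw [smul_mul_assoc, add_mul, hDp', hDsp, ← two_smul ℝ X, smul_smul]
    norm_num
  · have h1 := hDT T hTp hTX
    have h2 : Commute T (star D) := by simpa [hT.star_eq] using h1.star_star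
    exact (h1.add_right h2).smul_right _

/-- The sign of a self-adjoint operator `Y` is `2 • E - 1` for the projection `E` onto the kernel of
the negative part of `Y`. -/
lemma ContinuousLinearMap.exists_isStarProjection_sign {Y : H →L[ℂ] H} (hY : IsSelfAdjoint Y) :
    ∃ E : H →L[ℂ] H, IsStarProjection E ∧ (E * CFC.abs Y - (1 - E) * CFC.abs Y = Y) ∧
      ∀ T : H →L[ℂ] H, IsSelfAdjoint T → Commute T Y → Commute T E := by
  have hneg : IsSelfAdjoint Y⁻ := (CFC.negPart_nonneg Y).isSelfAdjoint
  set E := (Y⁻).ker.starProjection with hE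
  have hEpos : E * Y⁺ = Y⁺ := by
    refine ContinuousLinearMap.ext fun v ↦ ?_
    refine Submodule.starProjection_eq_self_iff.mpr ?_
    exact DFunLike.congr_fun (CFC.negPart_mul_posPart Y) v
  have hEneg : E * Y⁻ = 0 := by
    have h1 : Y⁻ * E = 0 := ContinuousLinearMap.ext fun v ↦
      Submodule.starProjection_apply_mem (Y⁻).ker v
    have h2 : Commute Y⁻ E := commute_starProjection_ker hneg (.refl _)
    rw [← h2.eq, h1]
  refine ⟨E, isStarProjection_starProjection, ?_, fun T hT hTY ↦ ?_⟩
  · rw [← CFC.posPart_add_negPart Y hY]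
    conv_rhs => rw [← CFC.posPart_sub_negPart Y hY]
    simp only [sub_mul, mul_add, one_mul, hEpos, hEneg]
    abel
  · exact commute_starProjection_ker hT (hTY.symm.cfcₙ_real _).symm

end Operators

/-! ### Exponentials -/

section Exponential

/-- The operator form of `exp (i arccos c) = c + i √(1 - c²)`. -/
lemma exp_I_smul_cfc_arccos {A : Type*} [CStarAlgebra A] {C : A} (hC : IsSelfAdjoint C)
    (hC1 : ‖C‖ ≤ 1) :
    NormedSpace.exp (I • cfc Real.arccos C) =
      C + I • cfc (fun x : ℝ ↦ Real.sqrt (1 - x ^ 2)) C := by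
  have hB : I • cfc Real.arccos C = cfc (fun z : ℂ ↦ I * (Real.arccos z.re : ℂ)) C := by
    rw [cfc_const_mul I (fun z : ℂ ↦ (Real.arccos z.re : ℂ)) C
      (by fun_prop), ← cfc_real_eq_complex Real.arccos hC]
  have hR : C + I • cfc (fun x : ℝ ↦ Real.sqrt (1 - x ^ 2)) C =
      cfc (fun z : ℂ ↦ (z.re : ℂ) + I * (Real.sqrt (1 - z.re ^ 2) : ℂ)) C := by
    rw [cfc_add C (fun z : ℂ ↦ (z.re : ℂ)) (fun z : ℂ ↦ I * (Real.sqrt (1 - z.re ^ 2) : ℂ))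
        (by fun_prop) (by fun_prop),
      cfc_const_mul I (fun z : ℂ ↦ (Real.sqrt (1 - z.re ^ 2) : ℂ)) C (by fun_prop),
      ← cfc_real_eq_complex (fun x ↦ Real.sqrt (1 - x ^ 2)) hC,
      ← cfc_real_eq_complex (fun x ↦ x) hC, cfc_id' ℝ C]
  have hCn : IsStarNormal C := hC.isStarNormal
  rw [hB, hR, ← CFC.complex_exp_eq_normedSpace_exp (cfc_predicate _ C),
    ← cfc_comp' Complex.exp (fun z : ℂ ↦ I * (Real.arccos z.re : ℂ)) C (by fun_prop) (by fun_prop)]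
  refine cfc_congr fun z hz ↦ ?_
  obtain _ | _ := subsingleton_or_nontrivial A
  · rw [spectrum.of_subsingleton] at hz
    exact hz.elim
  have hz1 : |z.re| ≤ 1 :=
    (Complex.abs_re_le_norm z).trans ((spectrum.norm_le_norm_of_mem hz).trans hC1)
  obtain ⟨h1, h2⟩ := abs_le.mp hz1
  rw [mul_comm, Complex.exp_mul_I, ← Complex.ofReal_cos, ← Complex.ofReal_sin,
    Real.cos_arccos h1 h2, Real.sin_arccos, mul_comm I]

/-- Exponentiating a block diagonal element with blocks `b` and `-b`. -/
lemma exp_mul_sub_of_isIdempotentElem {A : Type*} [NormedRing A] [NormedAlgebra ℂ A]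
    [CompleteSpace A] {e b : A} (he : IsIdempotentElem e) (h : Commute e b) :
    NormedSpace.exp (e * b - (1 - e) * b) =
      e * NormedSpace.exp b + (1 - e) * NormedSpace.exp (-b) := by
  let _ : NormedAlgebra ℚ A := NormedAlgebra.restrictScalars ℚ ℂ A
  have hee : e * e = e := he
  set a := e * b - (1 - e) * b with ha
  have hea : Commute e a := (((Commute.refl e).mul_right h)).sub_right
    ((((Commute.one_right e).sub_right (.refl e))).mul_right h)
  have h1 : SemiconjBy e a b := by
    show e * a = b * e
    rw [← h.eq, ha, mul_sub, ← mul_assoc, ← mul_assoc, mul_sub, hee, mul_one, sub_self, zero_mul,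
      sub_zero]
  have h2 : SemiconjBy (1 - e) a (-b) := by
    show (1 - e) * a = -b * (1 - e)
    have : e * a = e * b := by rw [h1.eq, h.eq]
    rw [sub_mul, one_mul, this, ha, sub_mul, one_mul, neg_mul, mul_sub, mul_one, ← h.eq]
    abel
  have h3 := h1.exp_right.eq
  have h4 := h2.exp_right.eq
  have h5 : Commute e (NormedSpace.exp b) := h.exp_right
  have h6 : Commute (1 - e) (NormedSpace.exp (-b)) :=
    ((Commute.one_left b).sub_left h).neg_right.exp_right
  rw [h5.eq, h6.eq, ← h3, ← h4]
  noncomm_ring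

end Exponential

/-! ### The argument of a normal operator and its roots -/

section Roots

variable {H : Type*} [NormedAddCommGroup H] [InnerProductSpace ℂ H] [CompleteSpace H]

/-- The self-adjoint operator `A` plays the role of the argument of `N`. -/
lemma ContinuousLinearMap.exists_isSelfAdjoint_abs_mul_exp (N : H →L[ℂ] H) [IsStarNormal N] :
    ∃ A : H →L[ℂ] H, IsSelfAdjoint A ∧ Commute A (CFC.abs N) ∧
      CFC.abs N * NormedSpace.exp (I • A) = N := by
  set p := CFC.abs N with hp
  set X : H →L[ℂ] H := ↑(ℜ N) with hXdef
  set Y : H →L[ℂ] H := ↑(ℑ N) with hYdef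
  have hX : IsSelfAdjoint X := (ℜ N).2
  have hY : IsSelfAdjoint Y := (ℑ N).2
  have hXY : Commute X Y := Commute.realPart_imaginaryPart N
  have hN : X + I • Y = N := realPart_add_I_smul_imaginaryPart N
  have hp0 : 0 ≤ p := CFC.abs_nonneg N
  have hpsa : IsSelfAdjoint p := hp0.isSelfAdjoint
  have hpp : p * p = X * X + Y * Y := by
    rw [hp, CFC.abs_mul_abs, star_mul_self_eq_realPart_sq_add_imaginaryPart_sq]
  -- An operator commuting with `X` and `Y` commutes with `|N| = √(N⋆ N)`.
  have hcomm : ∀ T : H →L[ℂ] H, Commute T X → Commute T Y → Commute p T := by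
    intro T hTX hTY
    have h : Commute (star N * N) T := by
      rw [star_mul_self_eq_realPart_sq_add_imaginaryPart_sq N]
      exact ((hTX.mul_right hTX).add_right (hTY.mul_right hTY)).symm
    exact h.cfcₙ_nnreal _
  have hpX : Commute p X := hcomm X (.refl X) hXY
  have hpY : Commute p Y := hcomm Y hXY.symm (.refl Y)
  have hle : ∀ v, ‖X v‖ ≤ ‖p v‖ := by
    intro v
    have key : ∀ S : H →L[ℂ] H, IsSelfAdjoint S → inner ℂ ((S * S) v) v = (‖S v‖ : ℂ) ^ 2 := by
      intro S hS
      exact (hS.isSymmetric.apply_clm (S v) v).trans (inner_self_eq_norm_sq_to_K (S v))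
    have h1 : ((‖p v‖ : ℂ)) ^ 2 = (‖X v‖ : ℂ) ^ 2 + (‖Y v‖ : ℂ) ^ 2 := by
      rw [← key p hpsa, ← key X hX, ← key Y hY, hpp, add_apply, inner_add_left]
    have h2 : ‖p v‖ ^ 2 = ‖X v‖ ^ 2 + ‖Y v‖ ^ 2 := by exact_mod_cast h1
    exact le_of_sq_le_sq (by nlinarith [sq_nonneg ‖Y v‖]) (norm_nonneg _)
  obtain ⟨C, hC, hC1, hCp, hCcomm⟩ := exists_isSelfAdjoint_mul_eq hpsa hX hpX hle
  obtain ⟨E, hE, hEY, hEcomm⟩ := exists_isStarProjection_sign hY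
  have hpC : Commute p C := hCcomm p hpsa (.refl p) hpX
  have hYC : Commute Y C := hCcomm Y hY hpY.symm hXY.symm
  have hEC : Commute E C := (hEcomm C hC hYC.symm).symm
  have hEp : Commute E p := (hEcomm p hpsa hpY).symm
  set B := cfc Real.arccos C with hB
  set W := cfc (fun x : ℝ ↦ Real.sqrt (1 - x ^ 2)) C with hW
  have hBsa : IsSelfAdjoint B := cfc_predicate _ C
  have hEB : Commute E B := (hEC.symm.cfc_real _).symm
  have hpB : Commute p B := (hpC.symm.cfc_real _).symm
  have hpW : Commute p W := (hpC.symm.cfc_real _).symm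
  have hW0 : 0 ≤ W := cfc_nonneg fun x _ ↦ Real.sqrt_nonneg _
  have hWsa : IsSelfAdjoint W := hW0.isSelfAdjoint
  have hWW : W * W = 1 - C * C := by
    rw [hW, ← cfc_mul (fun x : ℝ ↦ Real.sqrt (1 - x ^ 2)) _ C (by fun_prop) (by fun_prop)]
    have : (1 : H →L[ℂ] H) - C * C = cfc (fun x : ℝ ↦ 1 - x * x) C := by
      rw [cfc_sub (fun _ : ℝ ↦ 1) (fun x ↦ x * x) C (by fun_prop) (by fun_prop),
        cfc_mul (fun x : ℝ ↦ x) (fun x ↦ x) C (by fun_prop) (by fun_prop), cfc_id' ℝ C,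
        cfc_const_one ℝ C]
    rw [this]
    refine cfc_congr fun x hx ↦ ?_
    have hx1 : |x| ≤ 1 := by
      obtain _ | _ := subsingleton_or_nontrivial (H →L[ℂ] H)
      · rw [spectrum.of_subsingleton] at hx
        exact hx.elim
      exact (spectrum.norm_le_norm_of_mem hx).trans hC1
    have : x ^ 2 ≤ 1 := (sq_le_one_iff_abs_le_one x).mpr hx1
    rw [Real.mul_self_sqrt (by linarith), sq]
  have hpWY : p * W = CFC.abs Y := by
    refine (CFC.sqrt_unique ?_ (hpW.mul_nonneg hp0 hW0)).symm
    calc p * W * (p * W) = p * p * (W * W) := hpW.symm.mul_mul_mul_comm p W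
      _ = p * p - (p * C) * (C * p) := by
        rw [hWW, mul_sub, mul_one, mul_assoc p C, ← mul_assoc C C p, ← (hpC.mul_right hpC).eq,
          mul_assoc p p]
      _ = star Y * Y := by
        rw [hpC.eq, hCp, hpp, hY.star_eq, add_sub_cancel_left]
  have hexp : NormedSpace.exp (I • B) = C + I • W := exp_I_smul_cfc_arccos hC hC1
  have hexp' : NormedSpace.exp (-(I • B)) = C - I • W := by
    have h1 : -(I • B) = star (I • B) := by
      rw [star_smul, hBsa.star_eq, Complex.star_def, Complex.conj_I, neg_smul]
    rw [h1, ← NormedSpace.star_exp, hexp, star_add, star_smul, hC.star_eq, hWsa.star_eq,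
      Complex.star_def, Complex.conj_I, neg_smul, sub_eq_add_neg]
  refine ⟨E * B - (1 - E) * B, ?_, ?_, ?_⟩
  · have h1 : Commute (1 - E) B := (Commute.one_left B).sub_left hEB
    have hE1 : IsSelfAdjoint (1 - E) := (IsSelfAdjoint.one _).sub hE.isSelfAdjoint
    exact ((hE.isSelfAdjoint.commute_iff hBsa).mp hEB).sub ((hE1.commute_iff hBsa).mp h1)
  · exact (hEp.mul_left hpB.symm).sub_left
      (((Commute.one_left p).sub_left hEp).mul_left hpB.symm)
  · have h1 : I • (E * B - (1 - E) * B) = E * (I • B) - (1 - E) * (I • B) := by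
      rw [smul_sub, mul_smul_comm, mul_smul_comm]
    rw [h1, exp_mul_sub_of_isIdempotentElem hE.isIdempotentElem (hEB.smul_right I), hexp, hexp']
    calc p * (E * (C + I • W) + (1 - E) * (C - I • W))
        = p * C + I • (p * E * W - p * (1 - E) * W) := by
          simp only [mul_add, mul_sub, sub_mul, mul_smul_comm, one_mul, mul_one, smul_sub,
            mul_assoc]
          abel
      _ = p * C + I • (E * (p * W) - (1 - E) * (p * W)) := by
          rw [← hEp.eq, ← ((Commute.one_left p).sub_left hEp).eq, mul_assoc, mul_assoc]
      _ = N := by rw [hpWY, hEY, hpC.eq, hCp, hN]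

end Roots

theorem mainTheorem1 {H : Type*} [NormedAddCommGroup H] [InnerProductSpace ℂ H] [CompleteSpace H]
    (N : H →L[ℂ] H) (hN : IsStarNormal N) :
    ∃ A : H →L[ℂ] H, IsSelfAdjoint A ∧
      N = NormedSpace.exp (Complex.I • A) * CFC.abs N ∧
      N = CFC.abs N * NormedSpace.exp (Complex.I • A) ∧
      ∀ n : ℕ, 1 ≤ n → ∀ k : ℤ, ∀ M : H →L[ℂ] H,
        M = CFC.abs N ^ (1 / (n : ℝ)) *
          NormedSpace.exp ((Complex.I / (n : ℂ)) •
            (A + (2 * (k : ℂ) * (Real.pi : ℂ)) • (1 : H →L[ℂ] H))) →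
        IsStarNormal M ∧ M ^ n = N := by
  let _ : NormedAlgebra ℚ (H →L[ℂ] H) := NormedAlgebra.restrictScalars ℚ ℂ _
  obtain ⟨A, hA, hAp, hAN⟩ := exists_isSelfAdjoint_abs_mul_exp N
  refine ⟨A, hA, ?_, hAN.symm, ?_⟩
  · rw [((hAp.smul_left I).exp_left).eq, hAN]
  rintro n hn k M rfl
  have hn0 : (n : ℂ) ≠ 0 := by exact_mod_cast (by lia : n ≠ 0)
  have hn0' : (n : ℝ) ≠ 0 := by exact_mod_cast (by lia : n ≠ 0)
  set p := CFC.abs N with hp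
  have hp0 : 0 ≤ p := CFC.abs_nonneg N
  set R := p ^ (1 / (n : ℝ)) with hR
  have hRsa : IsSelfAdjoint R := CFC.rpow_nonneg.isSelfAdjoint
  set A' := A + (2 * (k : ℂ) * (Real.pi : ℂ)) • (1 : H →L[ℂ] H) with hA'
  have hA'sa : IsSelfAdjoint A' := by
    refine hA.add (IsSelfAdjoint.smul ?_ (.one _))
    have : 2 * (k : ℂ) * (Real.pi : ℂ) = ((2 * k * Real.pi : ℝ) : ℂ) := by push_cast; rfl
    rw [this]
    exact Complex.conj_ofReal _
  have hA'R : Commute A' R := by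
    have h1 : Commute A' p := hAp.add_left ((Commute.one_left p).smul_left _)
    exact (h1.symm.cfc_nnreal _).symm
  set V := NormedSpace.exp ((I / (n : ℂ)) • A') with hV
  have hVR : Commute V R := (hA'R.smul_left _).exp_left
  have hVV : Commute (star V) V := by
    rw [hV, NormedSpace.star_exp, star_smul, hA'sa.star_eq]
    exact (((Commute.refl A').smul_left _).smul_right _).exp
  have hVsR : Commute (star V) R := by simpa [hRsa.star_eq] using hVR.star_star
  refine ⟨⟨?_⟩, ?_⟩
  · rw [star_mul, hRsa.star_eq]
    exact ((hVsR.mul_left (.refl R)).mul_right (hVV.mul_left hVR.symm))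
  · have hRn : R ^ n = p := by
      rw [← CFC.rpow_natCast R n CFC.rpow_nonneg, hR,
        CFC.rpow_rpow_of_exponent_nonneg p _ _ (by positivity) (by positivity) hp0,
        one_div_mul_cancel hn0', CFC.rpow_one p hp0]
    -- The summand `2kπ` of `A'` contributes the scalar `exp (2kπi) = 1`.
    have hVn : V ^ n = NormedSpace.exp (I • A) := by
      have h1 : n • ((I / (n : ℂ)) • A') =
          I • A + algebraMap ℂ (H →L[ℂ] H) (k * (2 * Real.pi * I)) := by
        rw [← Nat.cast_smul_eq_nsmul ℂ, smul_smul, mul_div_cancel₀ _ hn0, hA', smul_add, smul_smul,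
          Algebra.algebraMap_eq_smul_one]
        congr 2
        ring
      rw [hV, ← NormedSpace.exp_nsmul, h1,
        NormedSpace.exp_add_of_commute (Algebra.commutes _ _).symm,
        ← NormedSpace.algebraMap_exp_comm, ← Complex.exp_eq_exp_ℂ, Complex.exp_int_mul_two_pi_mul_I,
        map_one, mul_one]
    rw [hVR.symm.mul_pow, hRn, hVn, hAN]
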